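/- Let $n\ge 1$. Let $\mathcal I_n(123)$ be the set of permutations $\pi$ of $\{1,\dots,n\}$ with $\pi=\pi^{-1}$ (involutions, including the identity when it qualifies) for which there are no $i<j<k$ with $\pi(i)<\pi(j)<\pi(k)$. For such $\pi$, let $\mathrm{comaj}(\pi)=\sum_{i\in \mathrm{Asc}(\pi)} i$, where $\mathrm{Asc}(\pi)=\{\,1\le i<n : \pi(i)<\pi(i+1)\,\}$ is the set of ascent positions of $\pi$. Then, as polynomials in $q$, $$\sum_{\pi\in\mathcal I_n(123)} q^{\mathrm{comaj}(\pi)}=\binom{n}{\lfloor n/2\rfloor}_q,$$ where $$\binom{n}{j}_q=\frac{(1-q^n)(1-q^{n-1})\cdots(1-q^{n-j+1})}{(1-q^j)(1-q^{j-1})\cdots(1-q)}$$ is the $q$-binomial coefficient. -/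

import Mathlib

open Polynomial

/-- `π` avoids the pattern `123`: there are no positions `i < j < k` with
`π i < π j < π k`. -/
def Avoids123 {n : ℕ} (π : Equiv.Perm (Fin n)) : Prop :=
  ¬ ∃ i j k : Fin n, i < j ∧ j < k ∧ π i < π j ∧ π j < π k

instance instDecidableAvoids123 {n : ℕ} (π : Equiv.Perm (Fin n)) : Decidable (Avoids123 π) := by
  unfold Avoids123
  infer_instance

/-- The set `I_n(123)` of involutions (permutations equal to their inverse) of an `n`-element
linearly ordered set that avoid `123`. -/
def involutionsAvoiding123 (n : ℕ) : Finset (Equiv.Perm (Fin n)) :=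
  {π : Equiv.Perm (Fin n) | π = π⁻¹ ∧ Avoids123 π}

/-- The set of ascent positions of `π`, as a subset of `{1, …, n - 1}`. Positions are counted from
`1`, while `Fin n` is counted from `0`: position `i` is the element `i - 1` of `Fin n`, and the next
position is the element `i`. -/
def ascentSet {n : ℕ} (π : Equiv.Perm (Fin n)) : Finset ℕ :=
  {i ∈ Finset.Ico 1 n | ∃ a b : Fin n, a.val + 1 = i ∧ b.val = i ∧ π a < π b}

/-- The comajor index: the sum of the ascent positions. -/
def comaj {n : ℕ} (π : Equiv.Perm (Fin n)) : ℕ := ∑ i ∈ ascentSet π, i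

/-- `(1 - q^n) (1 - q^(n-1)) ⋯ (1 - q^(n-j+1))`. (If `n < j`, the factor with `i = n` is zero.) -/
noncomputable def qFalling (n j : ℕ) : ℚ[X] := ∏ i ∈ Finset.range j, (1 - X ^ (n - i))

/-- The `q`-binomial coefficient
`((1 - q^n) ⋯ (1 - q^(n-j+1))) / ((1 - q^j) ⋯ (1 - q))`, as a polynomial in `q`. The quotient of
polynomials is exact, see `qBinomial_mul`. -/
noncomputable def qBinomial (n j : ℕ) : ℚ[X] := qFalling n j / qFalling j j

theorem qFalling_succ_succ (n j : ℕ) :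
    qFalling (n + 1) (j + 1) = (1 - X ^ (n + 1)) * qFalling n j := by
  simp [qFalling, Finset.prod_range_succ', mul_comm]

theorem qFalling_succ (n j : ℕ) :
    qFalling n (j + 1) = qFalling n j * (1 - X ^ (n - j)) := by
  simp [qFalling, Finset.prod_range_succ]

theorem qFalling_dvd (n j : ℕ) : qFalling j j ∣ qFalling n j := by
  induction n generalizing j with
  | zero =>
    cases j with
    | zero => simp
    | succ j => simp [qFalling, Finset.prod_range_succ']
  | succ n ih =>
    cases j with
    | zero => simp [qFalling]
    | succ j =>
      rcases le_or_gt j n with h | h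
      · have e : qFalling (n + 1) (j + 1)
            = qFalling n (j + 1) + X ^ (n - j) * qFalling n j * (1 - X ^ (j + 1)) := by
          have hx : (X : ℚ[X]) ^ (n + 1) = X ^ (n - j) * X ^ (j + 1) := by
            rw [← pow_add]
            congr 1
            omega
          rw [qFalling_succ_succ, qFalling_succ, hx]
          ring
        rw [e]
        refine dvd_add (ih (j + 1)) ?_
        rw [qFalling_succ_succ, mul_comm]
        exact mul_dvd_mul (dvd_mul_of_dvd_right (ih j) _) dvd_rfl
      · have e : qFalling (n + 1) (j + 1) = 0 :=
          Finset.prod_eq_zero (i := n + 1) (Finset.mem_range.2 (by omega)) (by simp)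
        simp [e]

theorem qFalling_self_ne_zero (j : ℕ) : qFalling j j ≠ 0 := by
  refine Finset.prod_ne_zero_iff.2 fun i hi h => ?_
  have hi' := Finset.mem_range.1 hi
  have h0 := congrArg (Polynomial.eval 2) h
  have h1 : (1 : ℚ) < 2 ^ (j - i) := one_lt_pow₀ (by norm_num) (by omega)
  simp at h0
  linarith

/-- The quotient defining `qBinomial` is exact. -/
theorem qBinomial_mul (n j : ℕ) : qBinomial n j * qFalling j j = qFalling n j := by
  rw [mul_comm]
  exact EuclideanDomain.mul_div_cancel' (qFalling_self_ne_zero j) (qFalling_dvd n j)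

/-! Call a position `p`, counted from `0`, an up if `p + π p < n` and a down otherwise. If `π`
avoids `123` and `i < j`, `π i < π j`, then a count of values forces `i` to be an up and `j` a down.
Hence an involution avoiding `123` reverses the order within each of the two classes, is determined
by its word, and has its ascents exactly at the peaks (an up followed by a down). The words that
occur are those whose first `k + 1` letters never contain more downs than the last `k`. This turns
the left side into a peak-weighted sum over such words (`sum_pow_comaj`).

With all weights equal to `1`, read the letters alternately from the left and right ends and flip
those read from the right: the condition says that a path stays above a barrier, and the reflection
principle replaces the count by the sum of `sign (height + 1)` over all words.
`dominatedSum_eq_signSum` proves this for arbitrary peak weights; reflection is replaced by the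
invariance of the weighted sums under negation of the height (`heightSum_down_up_neg`).

The same invariance cancels the heights `h` and `-h` against each other unless `|h| ≤ 1`. What
remains is the sum over words with `n / 2` downs, which MacMahon's theorem
(`heightSum_eq_qBinomial`) evaluates. -/

/-! ### Words, heights and peak weights -/

/-- The sum of `F` over all words of length `n` in the letters `true` (up) and `false` (down). -/
def wordSum {R : Type*} [AddCommMonoid R] : ℕ → (List Bool → R) → R
  | 0, F => F []
  | n + 1, F => wordSum n (fun w => F (true :: w)) + wordSum n (fun w => F (false :: w))

/-- The height of the end point of a word: the number of ups minus the number of downs. -/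
def wordHeight : List Bool → ℤ
  | [] => 0
  | b :: w => wordHeight w + (if b then 1 else -1)

/-- The weight `φ s` of a peak at position `s`, and `1` if the adjacent letters `x`, `y` do not
form a peak. -/
def peakFactor {R : Type*} [One R] (φ : ℕ → R) (s : ℕ) : Bool → Bool → R
  | true, false => φ s
  | _, _ => 1

/-- The product of `φ i` over the peaks `i` of the word `x w y` whose first letter is at
position `s`. -/
def peakWeight {R : Type*} [MulOneClass R] (φ : ℕ → R) (s : ℕ) (x : Bool) :
    List Bool → Bool → R
  | [], y => peakFactor φ s x y
  | z :: w, y => peakFactor φ s x z * peakWeight φ (s + 1) z w y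

section WordSum

variable {R : Type*}

theorem wordSum_succ_right [AddCommMonoid R] (n : ℕ) (F : List Bool → R) :
    wordSum (n + 1) F =
      wordSum n (fun w => F (w ++ [true])) + wordSum n (fun w => F (w ++ [false])) := by
  induction n generalizing F with
  | zero => simp [wordSum]
  | succ n ih =>
    rw [wordSum, ih, ih]
    simp only [wordSum, List.cons_append]
    abel

theorem wordSum_congr [AddCommMonoid R] {n : ℕ} {F F' : List Bool → R}
    (h : ∀ w : List Bool, w.length = n → F w = F' w) : wordSum n F = wordSum n F' := by
  induction n generalizing F F' with
  | zero => exact h [] rfl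
  | succ n ih =>
    rw [wordSum, wordSum, ih fun w hw => h (true :: w) (by simp [hw]),
      ih fun w hw => h (false :: w) (by simp [hw])]

theorem wordSum_add [AddCommMonoid R] (n : ℕ) (F F' : List Bool → R) :
    wordSum n (fun w => F w + F' w) = wordSum n F + wordSum n F' := by
  induction n generalizing F F' with
  | zero => rfl
  | succ n ih => simp only [wordSum, ih]; abel

theorem wordSum_mul_left [NonUnitalNonAssocSemiring R] (n : ℕ) (c : R) (F : List Bool → R) :
    wordSum n (fun w => c * F w) = c * wordSum n F := by
  induction n generalizing F with
  | zero => rfl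
  | succ n ih => simp only [wordSum, ih, mul_add]

theorem wordSum_zero [AddCommMonoid R] (n : ℕ) : wordSum n (fun _ => (0 : R)) = 0 := by
  induction n with
  | zero => rfl
  | succ n ih => simp only [wordSum, ih, add_zero]

theorem sum_ofFn_eq_wordSum [AddCommMonoid R] (n : ℕ) (F : List Bool → R) :
    ∑ w : Fin n → Bool, F (List.ofFn w) = wordSum n F := by
  induction n generalizing F with
  | zero => simp [wordSum]
  | succ n ih =>
    rw [← (Fin.consEquiv fun _ => Bool).sum_comp, Fintype.sum_prod_type]
    simp [wordSum, Fin.consEquiv, List.ofFn_succ, ← ih]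

theorem wordHeight_append (w : List Bool) (b : Bool) :
    wordHeight (w ++ [b]) = wordHeight w + (if b then 1 else -1) := by
  induction w with
  | nil => simp [wordHeight]
  | cons c w ih => simp only [List.cons_append, wordHeight, ih]; ring

theorem abs_wordHeight_le (w : List Bool) : |wordHeight w| ≤ w.length := by
  induction w with
  | nil => simp [wordHeight]
  | cons c w ih =>
    rw [abs_le] at *
    cases c <;> simp [wordHeight] <;> omega

theorem even_wordHeight_add_length (w : List Bool) : Even (wordHeight w + w.length) := by
  induction w with
  | nil => simp [wordHeight]
  | cons c w ih =>
    rw [Int.even_iff] at *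
    cases c <;> simp [wordHeight] <;> omega

variable [CommRing R] (φ : ℕ → R)

@[simp] theorem peakFactor_true_right (s : ℕ) (x : Bool) : peakFactor φ s x true = 1 := by
  cases x <;> rfl

@[simp] theorem peakFactor_false_left (s : ℕ) (y : Bool) : peakFactor φ s false y = 1 := by
  cases y <;> rfl

theorem peakWeight_append (s : ℕ) (x : Bool) (w : List Bool) (z y : Bool) :
    peakWeight φ s x (w ++ [z]) y =
      peakWeight φ s x w z * peakFactor φ (s + w.length + 1) z y := by
  induction w generalizing s x with
  | nil => simp [peakWeight]
  | cons c w ih =>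
    simp only [List.cons_append, peakWeight, ih, List.length_cons, mul_assoc]
    congr 4
    omega

/-- The sum of `f (height) * weight` over all words `w` of length `n`, where the weight is that
of the word `x w y` starting at position `s`. -/
def heightSum (s : ℕ) (x y : Bool) (n : ℕ) (f : ℤ → R) : R :=
  wordSum n fun w => f (wordHeight w) * peakWeight φ s x w y

theorem heightSum_zero (s : ℕ) (x y : Bool) (f : ℤ → R) :
    heightSum φ s x y 0 f = f 0 * peakFactor φ s x y := rfl

theorem heightSum_add (s : ℕ) (x y : Bool) (n : ℕ) (f g : ℤ → R) :
    heightSum φ s x y n (fun h => f h + g h) = heightSum φ s x y n f + heightSum φ s x y n g := by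
  simp only [heightSum, add_mul, wordSum_add]

theorem heightSum_neg (s : ℕ) (x y : Bool) (n : ℕ) (f : ℤ → R) :
    heightSum φ s x y n (fun h => -f h) = -heightSum φ s x y n f := by
  rw [eq_neg_iff_add_eq_zero, ← heightSum_add]
  simp [heightSum, wordSum_zero]

theorem heightSum_sub (s : ℕ) (x y : Bool) (n : ℕ) (f g : ℤ → R) :
    heightSum φ s x y n (fun h => f h - g h) = heightSum φ s x y n f - heightSum φ s x y n g := by
  simp only [sub_eq_add_neg, heightSum_add, heightSum_neg]

theorem heightSum_congr (s : ℕ) (x y : Bool) {n : ℕ} {f g : ℤ → R}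
    (h : ∀ a : ℤ, |a| ≤ n → Even (a + n) → f a = g a) :
    heightSum φ s x y n f = heightSum φ s x y n g := by
  refine wordSum_congr fun w hw => ?_
  rw [h _ (hw ▸ abs_wordHeight_le w) (hw ▸ even_wordHeight_add_length w)]

theorem heightSum_eq_zero (s : ℕ) (x y : Bool) {n : ℕ} {f : ℤ → R}
    (h : ∀ a : ℤ, |a| ≤ n → f a = 0) : heightSum φ s x y n f = 0 := by
  rw [heightSum_congr φ s x y (g := fun _ => 0) fun a ha _ => h a ha]
  simp [heightSum, wordSum_zero]

theorem heightSum_succ_left (s : ℕ) (x y : Bool) (n : ℕ) (f : ℤ → R) :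
    heightSum φ s x y (n + 1) f = heightSum φ (s + 1) true y n (fun h => f (h + 1)) +
      peakFactor φ s x false * heightSum φ (s + 1) false y n (fun h => f (h - 1)) := by
  simp only [heightSum, wordSum, ← wordSum_mul_left]
  congr 2 <;> funext w <;> simp [wordHeight, peakWeight, sub_eq_add_neg]
  ring

theorem heightSum_succ_right (s : ℕ) (x y : Bool) (n : ℕ) (f : ℤ → R) :
    heightSum φ s x y (n + 1) f =
      peakFactor φ (s + n + 1) true y * heightSum φ s x true n (fun h => f (h + 1)) +
      heightSum φ s x false n (fun h => f (h - 1)) := by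
  simp only [heightSum, wordSum_succ_right, ← wordSum_mul_left]
  congr 1 <;> refine wordSum_congr fun w hw => ?_ <;>
    simp [wordHeight_append, peakWeight_append, sub_eq_add_neg, hw]
  ring

theorem heightSum_add_two (s : ℕ) (x y : Bool) (n : ℕ) (f : ℤ → R) :
    heightSum φ s x y (n + 2) f =
      peakFactor φ (s + n + 2) true y * heightSum φ (s + 1) true true n (fun h => f (h + 2)) +
      heightSum φ (s + 1) true false n f +
      peakFactor φ s x false *
        (peakFactor φ (s + n + 2) true y * heightSum φ (s + 1) false true n f +
          heightSum φ (s + 1) false false n (fun h => f (h - 2))) := by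
  rw [heightSum_succ_left, heightSum_succ_right, heightSum_succ_right,
    show s + 1 + n + 1 = s + n + 2 by ring]
  simp only [add_sub_cancel_right, sub_add_cancel, add_assoc, sub_sub, one_add_one_eq_two,
    sub_add_cancel]

/-- The three-term recurrence obtained by removing the last letters of a word. -/
theorem heightSum_down_up_add_two (s n : ℕ) (f : ℤ → R) :
    heightSum φ s false true (n + 2) f =
      heightSum φ s false true (n + 1) (fun h => f (h + 1)) +
      heightSum φ s false true (n + 1) (fun h => f (h - 1)) -
      (1 - φ (s + n + 1)) * heightSum φ s false true n f := by
  -- Replacing the right neighbour up by a down only changes the weight of words ending in an up, by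
  -- the factor `φ (s + n + 1)`; comparing the two expansions eliminates the sums with right
  -- neighbour down.
  have h1 := heightSum_succ_right φ s false true n (fun h => f (h - 1))
  have h2 := heightSum_succ_right φ s false false n (fun h => f (h - 1))
  rw [heightSum_succ_right, h1, h2]
  simp only [peakFactor, add_sub_cancel_right]
  ring

/-- The three-term recurrence and its initial values are invariant under `h ↦ -h`. No
weight-preserving bijection on words is needed. -/
theorem heightSum_down_up_neg (s n : ℕ) (f : ℤ → R) :
    heightSum φ s false true n (fun h => f (-h)) = heightSum φ s false true n f := by
  induction n using Nat.twoStepInduction generalizing f with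
  | zero => simp [heightSum_zero]
  | one => simp [heightSum_succ_left, heightSum_zero]; ring
  | more n ih0 ih1 =>
    rw [heightSum_down_up_add_two, heightSum_down_up_add_two, ih0 f,
      ← ih1 (fun h => f (h + 1)), ← ih1 (fun h => f (h - 1))]
    have e1 : ∀ h : ℤ, -(h + 1) = -h - 1 := fun h => by ring
    have e2 : ∀ h : ℤ, -(h - 1) = -h + 1 := fun h => by ring
    simp only [e1, e2]
    ring

end WordSum

/-! ### Reversal-dominated words -/

/-- A word is reversal-dominated with slack `d` if, for all `k`, its first `k + 1` letters contain
at most `d` more downs than its last `k` letters. -/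
def RevDominated (d : ℕ) (w : List Bool) : Prop :=
  ∀ k < w.length, (w.take (k + 1)).count false ≤ d + (w.reverse.take k).count false

instance instDecidableRevDominated (d : ℕ) (w : List Bool) : Decidable (RevDominated d w) := by
  unfold RevDominated
  infer_instance

theorem revDominated_nil (d : ℕ) : RevDominated d [] := by
  simp [RevDominated]

theorem revDominated_singleton (d : ℕ) (x : Bool) :
    RevDominated d [x] ↔ [x].count false ≤ d := by
  simp [RevDominated]

/-- This is why a slack is carried along: stripping both end letters preserves the condition, with
the slack absorbing the difference of the letters. -/
theorem revDominated_cons_append (d : ℕ) (x y : Bool) (w : List Bool) :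
    RevDominated d (x :: (w ++ [y])) ↔
      [x].count false ≤ d ∧ RevDominated (d + [y].count false - [x].count false) w := by
  have key : ∀ k < w.length, ((x :: (w ++ [y])).take (k + 1 + 1)).count false =
      [x].count false + (w.take (k + 1)).count false ∧
      ((x :: (w ++ [y])).reverse.take (k + 1)).count false =
      [y].count false + (w.reverse.take k).count false := by
    intro k hk
    constructor
    · rw [List.take_succ_cons, List.take_append_of_le_length (by omega),
        ← List.singleton_append, List.count_append]
    · rw [List.reverse_cons, List.reverse_append, List.reverse_singleton, List.singleton_append,
        List.cons_append, List.take_succ_cons, List.take_append_of_le_length (by simp; omega),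
        ← List.singleton_append, List.count_append]
  constructor
  · intro h
    have h0 : [x].count false ≤ d := by simpa using h 0 (by simp)
    refine ⟨h0, fun k hk => ?_⟩
    have h1 := h (k + 1) (by simp; omega)
    rw [(key k hk).1, (key k hk).2] at h1
    omega
  · rintro ⟨h0, h⟩ k hk
    rcases k with _ | k
    · simpa using h0
    · by_cases hkw : k < w.length
      · rw [(key k hkw).1, (key k hkw).2]
        have := h k hkw
        omega
      -- The last inequality compares the whole word with all but its first letter, so it only says
      -- that the first letter respects the slack.
      · have hk' : k = w.length := by simp at hk; omega
        subst hk'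
        have e1 : ((x :: (w ++ [y])).take (w.length + 1 + 1)).count false =
            [x].count false + w.count false + [y].count false := by
          rw [List.take_of_length_le (by simp), ← List.singleton_append, List.count_append,
            List.count_append, add_assoc]
        have e2 : ((x :: (w ++ [y])).reverse.take (w.length + 1)).count false =
            [y].count false + w.count false := by
          rw [List.reverse_cons, List.reverse_append, List.take_append_of_le_length (by simp),
            List.take_of_length_le (by simp), List.count_append, List.reverse_singleton,
            List.count_reverse]
        rw [e1, e2]
        omega

section DominatedSum

variable {R : Type*} [CommRing R] (φ : ℕ → R)

/-- The sum of the weights of `x w y` over the words `w` of length `n` that are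
reversal-dominated with slack `d`. -/
def dominatedSum (s : ℕ) (x y : Bool) (n d : ℕ) : R :=
  wordSum n fun w => if RevDominated d w then peakWeight φ s x w y else 0

theorem dominatedSum_zero (s : ℕ) (x y : Bool) (d : ℕ) :
    dominatedSum φ s x y 0 d = peakFactor φ s x y := by
  simp [dominatedSum, wordSum, revDominated_nil, peakWeight]

theorem dominatedSum_one_zero (s : ℕ) (x y : Bool) :
    dominatedSum φ s x y 1 0 = peakFactor φ (s + 1) true y := by
  simp [dominatedSum, wordSum, revDominated_singleton, peakWeight]

theorem dominatedSum_one_succ (s : ℕ) (x y : Bool) (d : ℕ) :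
    dominatedSum φ s x y 1 (d + 1) = peakFactor φ (s + 1) true y + peakFactor φ s x false := by
  simp [dominatedSum, wordSum, revDominated_singleton, peakWeight]

theorem peakWeight_cons_append (s : ℕ) (x a b y : Bool) (w : List Bool) :
    peakWeight φ s x (a :: (w ++ [b])) y =
      peakFactor φ s x a * peakFactor φ (s + w.length + 2) b y * peakWeight φ (s + 1) a w b := by
  rw [peakWeight, peakWeight_append, show s + 1 + w.length + 1 = s + w.length + 2 by ring]
  ring

theorem wordSum_add_two (n : ℕ) (F : List Bool → R) :
    wordSum (n + 2) F = wordSum n (fun w => F (true :: (w ++ [true]))) +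
      wordSum n (fun w => F (true :: (w ++ [false]))) +
      (wordSum n (fun w => F (false :: (w ++ [true]))) +
        wordSum n (fun w => F (false :: (w ++ [false])))) := by
  rw [wordSum, wordSum_succ_right, wordSum_succ_right]

theorem dominatedSum_add_two_zero (s : ℕ) (x y : Bool) (n : ℕ) :
    dominatedSum φ s x y (n + 2) 0 =
      peakFactor φ (s + n + 2) true y * dominatedSum φ (s + 1) true true n 0 +
      dominatedSum φ (s + 1) true false n 1 := by
  simp only [dominatedSum, wordSum_add_two, ← wordSum_mul_left, revDominated_cons_append]
  simp only [List.count_singleton, peakWeight_cons_append]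
  simp only [beq_iff_eq, Bool.true_eq_false, if_false, if_true, le_refl, true_and, add_zero,
    Nat.sub_zero, Nat.le_zero, one_ne_zero, false_and, wordSum_zero, peakFactor_true_right,
    peakFactor_false_left, zero_add, one_mul, mul_one, mul_ite, mul_zero]
  congr 1
  refine wordSum_congr fun w hw => ?_
  rw [hw]

theorem dominatedSum_add_two_succ (s : ℕ) (x y : Bool) (n d : ℕ) :
    dominatedSum φ s x y (n + 2) (d + 1) =
      peakFactor φ (s + n + 2) true y * dominatedSum φ (s + 1) true true n (d + 1) +
      dominatedSum φ (s + 1) true false n (d + 2) +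
      peakFactor φ s x false *
        (peakFactor φ (s + n + 2) true y * dominatedSum φ (s + 1) false true n d +
          dominatedSum φ (s + 1) false false n (d + 1)) := by
  simp only [dominatedSum, wordSum_add_two, ← wordSum_mul_left, revDominated_cons_append, mul_add]
  simp only [List.count_singleton, peakWeight_cons_append]
  simp only [beq_iff_eq, Bool.true_eq_false, if_false, if_true, true_and, add_zero,
    Nat.sub_zero, peakFactor_true_right, Nat.add_sub_cancel, Nat.le_add_left,
    peakFactor_false_left, one_mul, mul_one, mul_ite, mul_zero]
  congr 2 <;> refine wordSum_congr fun w hw => ?_ <;> rw [hw]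
  split_ifs <;> ring

end DominatedSum

/-! ### Sign-weighted sums and the weighted reflection principle -/

section SignedSum

variable {R : Type*} [CommRing R] (φ : ℕ → R)

/-- The height sum weighted with the sign of `height + c`. -/
def signSum (s : ℕ) (x y : Bool) (n : ℕ) (c : ℤ) : R :=
  heightSum φ s x y n fun h => ((h + c).sign : R)

/-- The height sum weighted with the sign of `c - height`. -/
def coSignSum (s : ℕ) (x y : Bool) (n : ℕ) (c : ℤ) : R :=
  heightSum φ s x y n fun h => ((c - h).sign : R)

theorem coSignSum_down_up (s n : ℕ) (c : ℤ) :
    coSignSum φ s false true n c = signSum φ s false true n c := by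
  rw [coSignSum, signSum, ← heightSum_down_up_neg]
  simp [add_comm]

theorem signSum_succ_left (s : ℕ) (x y : Bool) (n : ℕ) (c : ℤ) :
    signSum φ s x y (n + 1) c = signSum φ (s + 1) true y n (c + 1) +
      peakFactor φ s x false * signSum φ (s + 1) false y n (c - 1) := by
  simp only [signSum, heightSum_succ_left, add_assoc, sub_add_eq_add_sub, add_sub_assoc,
    add_comm (1 : ℤ)]

theorem coSignSum_succ_left (s : ℕ) (x y : Bool) (n : ℕ) (c : ℤ) :
    coSignSum φ s x y (n + 1) c = coSignSum φ (s + 1) true y n (c - 1) +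
      peakFactor φ s x false * coSignSum φ (s + 1) false y n (c + 1) := by
  have e1 : ∀ h : ℤ, c - (h + 1) = c - 1 - h := fun h => by ring
  have e2 : ∀ h : ℤ, c - (h - 1) = c + 1 - h := fun h => by ring
  simp only [coSignSum, heightSum_succ_left, e1, e2]

theorem signSum_succ_right (s : ℕ) (x y : Bool) (n : ℕ) (c : ℤ) :
    signSum φ s x y (n + 1) c =
      peakFactor φ (s + n + 1) true y * signSum φ s x true n (c + 1) +
      signSum φ s x false n (c - 1) := by
  simp only [signSum, heightSum_succ_right, add_assoc, sub_add_eq_add_sub, add_sub_assoc,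
    add_comm (1 : ℤ)]

theorem coSignSum_succ_right (s : ℕ) (x y : Bool) (n : ℕ) (c : ℤ) :
    coSignSum φ s x y (n + 1) c =
      peakFactor φ (s + n + 1) true y * coSignSum φ s x true n (c - 1) +
      coSignSum φ s x false n (c + 1) := by
  have e1 : ∀ h : ℤ, c - (h + 1) = c - 1 - h := fun h => by ring
  have e2 : ∀ h : ℤ, c - (h - 1) = c + 1 - h := fun h => by ring
  simp only [coSignSum, heightSum_succ_right, e1, e2]

theorem signSum_add_two (s : ℕ) (x y : Bool) (n : ℕ) (c : ℤ) :
    signSum φ s x y (n + 2) c =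
      peakFactor φ (s + n + 2) true y * signSum φ (s + 1) true true n (c + 2) +
      signSum φ (s + 1) true false n c +
      peakFactor φ s x false *
        (peakFactor φ (s + n + 2) true y * signSum φ (s + 1) false true n c +
          signSum φ (s + 1) false false n (c - 2)) := by
  have e1 : ∀ h : ℤ, h + 2 + c = h + (c + 2) := fun h => by ring
  have e2 : ∀ h : ℤ, h - 2 + c = h + (c - 2) := fun h => by ring
  simp only [signSum, heightSum_add_two, e1, e2]

theorem coSignSum_add_two (s : ℕ) (x y : Bool) (n : ℕ) (c : ℤ) :
    coSignSum φ s x y (n + 2) c =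
      peakFactor φ (s + n + 2) true y * coSignSum φ (s + 1) true true n (c - 2) +
      coSignSum φ (s + 1) true false n c +
      peakFactor φ s x false *
        (peakFactor φ (s + n + 2) true y * coSignSum φ (s + 1) false true n c +
          coSignSum φ (s + 1) false false n (c + 2)) := by
  have e1 : ∀ h : ℤ, c - (h + 2) = c - 2 - h := fun h => by ring
  have e2 : ∀ h : ℤ, c - (h - 2) = c + 2 - h := fun h => by ring
  simp only [coSignSum, heightSum_add_two, e1, e2]

/-- Symmetry of the sums over words whose left neighbour is a down. -/
theorem coSignSum_down_down (s n : ℕ) (c : ℤ) :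
    coSignSum φ s false false n (c + 1) =
      signSum φ s false true n (c + 1) + signSum φ s false false n (c - 1) -
        signSum φ s false true n (c - 1) := by
  have h := coSignSum_down_up φ s (n + 1) c
  rw [coSignSum_succ_right, signSum_succ_right, coSignSum_down_up] at h
  simp only [peakFactor_true_right] at h
  linear_combination h

/-- Symmetry of the sums over words whose right neighbour is an up. -/
theorem coSignSum_up_up (s n : ℕ) (c : ℤ) :
    coSignSum φ (s + 1) true true n (c - 1) =
      signSum φ (s + 1) true true n (c + 1) + signSum φ (s + 1) false true n (c - 1) -
        signSum φ (s + 1) false true n (c + 1) := by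
  have h := coSignSum_down_up φ s (n + 1) c
  rw [coSignSum_succ_left, signSum_succ_left, coSignSum_down_up] at h
  simp only [peakFactor_false_left] at h
  linear_combination h

/-- Negation symmetry at length `n + 2`, split by both end letters, minus the two one-sided
symmetries `coSignSum_up_up` and `coSignSum_down_down`. -/
theorem coSignSum_up_down (s n : ℕ) (c : ℤ) :
    coSignSum φ (s + 1) true false n (c + 1) + coSignSum φ (s + 1) false false n (c + 3) =
      signSum φ (s + 1) true false n (c + 1) + signSum φ (s + 1) true true n (c + 3) -
        signSum φ (s + 1) true true n (c + 1) + coSignSum φ (s + 1) false false n (c + 1) := by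
  have h := coSignSum_down_up φ s (n + 2) (c + 1)
  have h1 := coSignSum_up_up φ s n c
  have h2 := coSignSum_down_down φ (s + 1) n c
  rw [coSignSum_add_two, signSum_add_two, coSignSum_down_up,
    show c + 1 - 2 = c - 1 by ring, show c + 1 + 2 = c + 3 by ring] at h
  simp only [peakFactor_true_right, peakFactor_false_left] at h
  linear_combination h - h1 - h2

/-- At `c = 0` the sign is odd in the height, so by negation symmetry the sum at length `n + 1`
vanishes; splitting it by the last letter gives the identity. -/
theorem signSum_down_zero [IsDomain R] [CharZero R] (s n : ℕ) :
    signSum φ s false true n 1 + signSum φ s false false n (-1) = 0 := by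
  have h := coSignSum_down_up φ s (n + 1) 0
  have h' : coSignSum φ s false true (n + 1) 0 = -signSum φ s false true (n + 1) 0 := by
    rw [coSignSum, signSum, ← heightSum_neg]
    simp
  rw [h', neg_eq_self, signSum_succ_right] at h
  simpa using h

theorem signSum_zero (s : ℕ) (x y : Bool) (c : ℤ) :
    signSum φ s x y 0 c = (c.sign : R) * peakFactor φ s x y := by
  simp [signSum, heightSum_zero]

theorem coSignSum_zero (s : ℕ) (x y : Bool) (c : ℤ) :
    coSignSum φ s x y 0 c = (c.sign : R) * peakFactor φ s x y := by
  simp [coSignSum, heightSum_zero]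

theorem dominatedSum_zero_eq_signSum (s d : ℕ) :
    (∀ x, dominatedSum φ s x true 0 d = signSum φ s x true 0 (2 * d + 1)) ∧
    dominatedSum φ s false false 0 (d + 1) = coSignSum φ s false false 0 (2 * d + 3) ∧
    dominatedSum φ s true false 0 (d + 1) = signSum φ s true false 0 (2 * d + 1) +
      signSum φ s true true 0 (2 * d + 3) - signSum φ s true true 0 (2 * d + 1) := by
  have p1 : (2 * (d : ℤ) + 1).sign = 1 := Int.sign_eq_one_of_pos (by omega)
  have p3 : (2 * (d : ℤ) + 3).sign = 1 := Int.sign_eq_one_of_pos (by omega)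
  simp [dominatedSum_zero, signSum_zero, coSignSum_zero, p1, p3]

theorem dominatedSum_one_eq_signSum (s d : ℕ) :
    (∀ x, dominatedSum φ s x true 1 d = signSum φ s x true 1 (2 * d + 1)) ∧
    dominatedSum φ s false false 1 (d + 1) = coSignSum φ s false false 1 (2 * d + 3) ∧
    dominatedSum φ s true false 1 (d + 1) = signSum φ s true false 1 (2 * d + 1) +
      signSum φ s true true 1 (2 * d + 3) - signSum φ s true true 1 (2 * d + 1) := by
  have p2 : (2 * (d : ℤ) + 1 + 1).sign = 1 := Int.sign_eq_one_of_pos (by omega)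
  have p2' : (2 * (d : ℤ) + 3 - 1).sign = 1 := Int.sign_eq_one_of_pos (by omega)
  have p4 : (2 * (d : ℤ) + 3 + 1).sign = 1 := Int.sign_eq_one_of_pos (by omega)
  simp only [signSum_succ_left, coSignSum_succ_left, signSum_zero, coSignSum_zero,
    dominatedSum_one_succ, p2, p2', p4, peakFactor_true_right, peakFactor_false_left,
    add_sub_cancel_right, Int.cast_one, one_mul, mul_one]
  refine ⟨fun x => ?_, trivial, by ring⟩
  rcases d with _ | d
  · simp [dominatedSum_one_zero]
  · have p0 : (2 * ((d + 1 : ℕ) : ℤ)).sign = 1 := Int.sign_eq_one_of_pos (by omega)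
    simp only [dominatedSum_one_succ, p0, Int.cast_one, mul_one, peakFactor_true_right]

/-- Evaluation of the sums over reversal-dominated words by sign-weighted sums over all words. -/
theorem dominatedSum_eq_signSum [IsDomain R] [CharZero R] (n s d : ℕ) :
    (∀ x, dominatedSum φ s x true n d = signSum φ s x true n (2 * d + 1)) ∧
    dominatedSum φ s false false n (d + 1) = coSignSum φ s false false n (2 * d + 3) ∧
    dominatedSum φ s true false n (d + 1) = signSum φ s true false n (2 * d + 1) +
      signSum φ s true true n (2 * d + 3) - signSum φ s true true n (2 * d + 1) := by
  -- Stripping both ends mixes the neighbour pairs, so the three formulas are proved together for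
  -- all slacks. A right neighbour down only arises with positive slack, hence `d + 1`.
  induction n using Nat.twoStepInduction generalizing s d with
  | zero => exact dominatedSum_zero_eq_signSum φ s d
  | one => exact dominatedSum_one_eq_signSum φ s d
  | more n ih _ =>
    have ihU := fun s d => (ih s d).1
    have ihDD := fun s d => (ih s d).2.1
    have ihUD := fun s d => (ih s d).2.2
    refine ⟨fun x => ?_, ?_, ?_⟩
    · rcases d with _ | d
      · rw [dominatedSum_add_two_zero, signSum_add_two, ihU, ihUD]
        -- With slack `0` no dominated word starts with a down; the sign sums over such words must
        -- cancel.
        have h := signSum_down_zero φ (s + 1) n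
        simp at h ⊢
        linear_combination -peakFactor φ s x false * h
      · rw [dominatedSum_add_two_succ, signSum_add_two, ihU, ihU, ihUD, ihDD]
        have h := coSignSum_down_down φ (s + 1) n (2 * d + 2)
        push_cast
        ring_nf at h ⊢
        simp only [peakFactor_true_right]
        linear_combination peakFactor φ s x false * h
    · rw [dominatedSum_add_two_succ, coSignSum_add_two, ihU, ihU, ihUD, ihDD]
      have h1 := coSignSum_up_down φ s n (2 * d + 2)
      have h2 := coSignSum_up_up φ s n (2 * d + 2)
      have h3 := coSignSum_down_up φ (s + 1) n (2 * d + 3)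
      push_cast
      ring_nf at h1 h2 h3 ⊢
      simp only [peakFactor_false_left]
      linear_combination (-1 : R) * h1 - peakFactor φ (2 + s + n) true false * (h2 + h3)
    · rw [dominatedSum_add_two_succ, signSum_add_two, signSum_add_two, signSum_add_two, ihU, ihU,
        ihUD, ihDD]
      have h := coSignSum_down_down φ (s + 1) n (2 * d + 2)
      push_cast
      ring_nf at h ⊢
      simp only [peakFactor_true_right]
      linear_combination peakFactor φ s true false * h

end SignedSum

/-! ### The `q`-binomial recurrence and MacMahon's theorem -/

theorem qBinomial_zero_right (n : ℕ) : qBinomial n 0 = 1 := by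
  have h := qBinomial_mul n 0
  simpa [qFalling] using h

theorem qBinomial_zero_succ (j : ℕ) : qBinomial 0 (j + 1) = 0 := by
  simp [qBinomial, qFalling, Finset.prod_range_succ']

theorem qBinomial_one_succ_succ (j : ℕ) : qBinomial 1 (j + 2) = 0 := by
  simp [qBinomial, qFalling, Finset.prod_range_succ']

theorem qBinomial_self (n : ℕ) : qBinomial n n = 1 :=
  EuclideanDomain.div_self (qFalling_self_ne_zero n)

/-- The three-term form, rather than a `q`-Pascal rule, matches `heightSum_down_up_add_two` with `φ
i = X ^ i`. -/
theorem qBinomial_add_two_succ (n j : ℕ) :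
    qBinomial (n + 2) (j + 1) = qBinomial (n + 1) (j + 1) + qBinomial (n + 1) j -
      (1 - X ^ (n + 1)) * qBinomial n j := by
  refine mul_right_cancel₀ (qFalling_self_ne_zero (j + 1)) ?_
  have h1 := qBinomial_mul (n + 2) (j + 1)
  have h2 := qBinomial_mul (n + 1) (j + 1)
  have h3 := qBinomial_mul (n + 1) j
  have h4 := qBinomial_mul n j
  have h5 := qFalling_succ_succ j j
  have h6 := qFalling_succ_succ (n + 1) j
  have h7 := qFalling_succ_succ n j
  have h8 := qFalling_succ (n + 1) j
  have h9 : qFalling (n + 1) j * X ^ (n + 1 - j) * X ^ (j + 1) =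
      qFalling (n + 1) j * X ^ (n + 2) := by
    -- For `j > n + 1` the truncated exponent is wrong, but `qFalling (n + 1) j` vanishes.
    rcases le_or_gt j (n + 1) with h | h
    · rw [mul_assoc, ← pow_add]
      congr 2
      omega
    · have e : qFalling (n + 1) j = 0 :=
        Finset.prod_eq_zero (i := n + 1) (Finset.mem_range.2 h) (by simp)
      simp [e]
  rw [sub_mul, add_mul, h1, h2, h5, h6]
  linear_combination (-(1 - X ^ (j + 1))) * h3 + (1 - X ^ (j + 1)) * (1 - X ^ (n + 1)) * h4 -
    (1 - X ^ (j + 1)) * h7 - X ^ (j + 1) * h8 + h9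

/-- MacMahon: the major index over words with `j` downs is distributed as the `q`-binomial
coefficient. -/
theorem heightSum_eq_qBinomial (n j : ℕ) :
    heightSum (fun i => (X : ℚ[X]) ^ i) 0 false true n
      (fun h => if h = (n : ℤ) - 2 * j then 1 else 0) = qBinomial n j := by
  induction n using Nat.twoStepInduction generalizing j with
  | zero =>
    rcases j with _ | j
    · simp [heightSum_zero, qBinomial_zero_right]
    · rw [heightSum_zero, qBinomial_zero_succ, if_neg (by omega), zero_mul]
  | one =>
    rcases j with _ | _ | j
    · simp [heightSum_succ_left, heightSum_zero, qBinomial_zero_right]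
    · simp [heightSum_succ_left, heightSum_zero, qBinomial_self]
    · rw [qBinomial_one_succ_succ, heightSum_succ_left, heightSum_zero, heightSum_zero,
        if_neg (by omega), if_neg (by omega)]
      simp
  | more n ih0 ih1 =>
    rw [heightSum_down_up_add_two]
    have a1 := ih1 j
    rcases j with _ | j
    · have z1 : heightSum (fun i => (X : ℚ[X]) ^ i) 0 false true (n + 1)
          (fun h => if h - 1 = ((n + 2 : ℕ) : ℤ) - 2 * ((0 : ℕ) : ℤ) then 1 else 0) = 0 := by
        refine heightSum_eq_zero _ 0 false true fun a ha => if_neg ?_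
        rw [abs_le] at ha
        omega
      have z2 : heightSum (fun i => (X : ℚ[X]) ^ i) 0 false true n
          (fun h => if h = ((n + 2 : ℕ) : ℤ) - 2 * ((0 : ℕ) : ℤ) then 1 else 0) = 0 := by
        refine heightSum_eq_zero _ 0 false true fun a ha => if_neg ?_
        rw [abs_le] at ha
        omega
      rw [z1, z2, mul_zero, sub_zero, add_zero, qBinomial_zero_right]
      refine Eq.trans ?_ (a1.trans (qBinomial_zero_right _))
      congr 1
      funext h
      simp only [Nat.cast_add, Nat.cast_zero, Nat.cast_one, Nat.cast_ofNat]
      exact if_congr (by omega) rfl rfl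
    · have a2 := ih1 j
      have a3 := ih0 j
      rw [qBinomial_add_two_succ, ← a1, ← a2, ← a3]
      have e1 : ∀ h : ℤ, h + 1 = ((n + 2 : ℕ) : ℤ) - 2 * ((j + 1 : ℕ) : ℤ) ↔
        h = ((n + 1 : ℕ) : ℤ) - 2 * ((j + 1 : ℕ) : ℤ) := fun h => by omega
      have e2 : ∀ h : ℤ, h - 1 = ((n + 2 : ℕ) : ℤ) - 2 * ((j + 1 : ℕ) : ℤ) ↔
        h = ((n + 1 : ℕ) : ℤ) - 2 * (j : ℤ) := fun h => by omega
      have e3 : ∀ h : ℤ, h = ((n + 2 : ℕ) : ℤ) - 2 * ((j + 1 : ℕ) : ℤ) ↔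
        h = (n : ℤ) - 2 * (j : ℤ) := fun h => by omega
      simp only [e1, e2, e3, zero_add]

theorem dominatedSum_eq_qBinomial (n : ℕ) :
    dominatedSum (fun i => (X : ℚ[X]) ^ i) 0 false true n 0 = qBinomial n (n / 2) := by
  rw [(dominatedSum_eq_signSum _ n 0 0).1, ← heightSum_eq_qBinomial, ← sub_eq_zero, signSum,
    ← heightSum_sub, ← self_eq_neg, ← heightSum_neg, ← heightSum_down_up_neg]
  -- It remains to see that `sign (h + 1)` minus the indicator of height `n - 2 * (n / 2)` is odd in
  -- `h` on heights of the parity of `n`: its sum then equals its own negative, hence is zero.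
  refine heightSum_congr _ 0 false true fun a _ ha => ?_
  rw [Int.even_iff] at ha
  have key : ∀ b : ℤ, 0 < b → b % 2 = n % 2 → (((b + 1).sign : ℤ) : ℚ[X]) -
      (if b = (n : ℤ) - 2 * ((n / 2 : ℕ) : ℤ) then 1 else 0) =
      -((((-b + 1).sign : ℤ) : ℚ[X]) -
        if -b = (n : ℤ) - 2 * ((n / 2 : ℕ) : ℤ) then 1 else 0) := by
    intro b hb hbn
    rw [Int.sign_eq_one_of_pos (by omega), if_neg (c := -b = _) (by omega)]
    by_cases h1 : b = 1
    · rw [if_pos (by omega), h1]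
      simp
    · rw [if_neg (by omega), Int.sign_eq_neg_one_of_neg (by omega)]
      simp
  simp only [Nat.cast_zero, mul_zero, zero_add]
  rcases lt_trichotomy a 0 with h | h | h
  · rw [key (-a) (by omega) (by omega), neg_neg]
  · subst h
    rw [if_pos (by omega), if_pos (by omega)]
    simp
  · rw [key a h (by omega), neg_neg]

/-! ### Involutions avoiding `123` and their words -/

section Permutations

open scoped Finset

theorem count_take_ofFn {n : ℕ} (w : Fin n → Bool) (k : ℕ) :
    ((List.ofFn w).take k).count false = #{c : Fin n | c.val < k ∧ w c = false} := by
  induction n generalizing k with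
  | zero => simp
  | succ n ih =>
    rcases k with _ | k
    · simp
    · rw [List.ofFn_succ, List.take_succ_cons, List.count_cons, ih, Fin.card_filter_univ_succ]
      by_cases h : w 0 = false <;> simp [h, add_comm]

theorem reverse_ofFn {α : Type*} {n : ℕ} (w : Fin n → α) :
    (List.ofFn w).reverse = List.ofFn fun i => w i.rev := by
  refine List.ext_getElem (by simp) fun i h1 h2 => ?_
  simp only [List.getElem_reverse, List.getElem_ofFn, List.length_ofFn]
  congr 1
  ext
  simp
  omega

theorem revDominated_ofFn {n : ℕ} (w : Fin n → Bool) :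
    RevDominated 0 (List.ofFn w) ↔ ∀ k < n, #{c : Fin n | c.val < k + 1 ∧ w c = false} ≤
      #{c : Fin n | n ≤ c.val + k ∧ w c = false} := by
  rw [RevDominated, List.length_ofFn]
  refine forall₂_congr fun k hk => ?_
  rw [zero_add, reverse_ofFn, count_take_ofFn, count_take_ofFn]
  have : #{c : Fin n | c.val < k ∧ w c.rev = false} =
      #{c : Fin n | n ≤ c.val + k ∧ w c = false} := by
    refine Finset.card_nbij' Fin.rev Fin.rev ?_ ?_ (by simp [Set.LeftInvOn]) (by simp [Set.LeftInvOn])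
    · intro c hc
      simp only [Finset.coe_filter, Finset.mem_univ, true_and, Set.mem_ofPred_eq, Fin.val_rev] at *
      exact ⟨by omega, hc.2⟩
    · intro c hc
      simp only [Finset.coe_filter, Finset.mem_univ, true_and, Set.mem_ofPred_eq, Fin.val_rev,
        Fin.rev_rev] at *
      exact ⟨by omega, hc.2⟩
  rw [← this]

theorem peakWeight_ofFn {R : Type*} [CommRing R] (φ : ℕ → R) {n : ℕ} (s : ℕ) (x : Bool)
    (w : Fin n → Bool) :
    peakWeight φ s x (List.ofFn w) true =
      ∏ p : Fin n, peakFactor φ (s + p) ((Fin.cons x w : Fin (n + 1) → Bool) p.castSucc) (w p) := by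
  induction n generalizing s x with
  | zero => simp [peakWeight]
  | succ n ih =>
    rw [List.ofFn_succ, peakWeight, ih, Fin.prod_univ_succ]
    congr 1
    refine Finset.prod_congr rfl fun p _ => ?_
    have h : (Fin.cons (w 0) (fun i => w i.succ) : Fin (n + 1) → Bool) = w :=
      Fin.cons_self_tail w
    rw [h, Fin.val_succ, Fin.castSucc_succ, Fin.cons_succ, add_right_comm, add_assoc s]

section Reversal

variable {n : ℕ}

/-- `π` is an involution that preserves each of the two classes of positions given by `w` and
reverses the order in each of them. -/
structure IsClassReversal (w : Fin n → Bool) (π : Equiv.Perm (Fin n)) : Prop where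
  involutive : ∀ p, π (π p) = p
  map_class : ∀ p, w (π p) = w p
  anti : ∀ i j, i < j → w i = w j → π j < π i

theorem exists_involutive_strictAnti (α : Type*) [Fintype α] [LinearOrder α] :
    ∃ ρ : Equiv.Perm α, (∀ x, ρ (ρ x) = x) ∧ ∀ x y, x < y → ρ y < ρ x := by
  let e := Fintype.orderIsoFinOfCardEq α rfl
  refine ⟨e.symm.toEquiv.trans (Fin.revPerm.trans e.toEquiv), fun x => ?_, fun x y h => ?_⟩
  · simp
  · simpa using h

theorem exists_isClassReversal (w : Fin n → Bool) : ∃ π, IsClassReversal w π := by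
  choose ρ h1 h2 using fun b => exists_involutive_strictAnti {x // w x = b}
  let π : Equiv.Perm (Fin n) := (Equiv.sigmaFiberEquiv w).symm.trans
    ((Equiv.sigmaCongrRight ρ).trans (Equiv.sigmaFiberEquiv w))
  have hπ : ∀ b (x : {x // w x = b}), π x = ρ b x := by
    rintro b ⟨x, rfl⟩
    rfl
  refine ⟨π, fun p => ?_, fun p => ?_, fun i j hij hw => ?_⟩
  · rw [hπ (w p) ⟨p, rfl⟩, hπ, h1]
  · rw [hπ (w p) ⟨p, rfl⟩]
    exact (ρ (w p) ⟨p, rfl⟩).2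
  · rw [hπ (w j) ⟨i, hw⟩, hπ (w j) ⟨j, rfl⟩]
    exact h2 _ _ _ hij

namespace IsClassReversal

variable {w : Fin n → Bool} {π π' : Equiv.Perm (Fin n)}

theorem anti_iff (h : IsClassReversal w π) {i j : Fin n} (hw : w i = w j) :
    i < j ↔ π j < π i := by
  refine ⟨fun hij => h.anti i j hij hw, fun hij => ?_⟩
  have := h.anti _ _ hij (by rw [h.map_class, h.map_class, hw])
  rwa [h.involutive, h.involutive] at this

/-- The involution exchanges the members of the class before `p` with those after `π p`. The rank of
`π p` in its class is thus fixed by `p`, which yields `unique`. -/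
theorem card_lt_eq (h : IsClassReversal w π) (p : Fin n) :
    #{x | x < p ∧ w x = w p} = #{x | π p < x ∧ w x = w p} := by
  refine Finset.card_nbij' π π ?_ ?_ (fun x _ => h.involutive x) (fun x _ => h.involutive x)
  · intro x hx
    simp only [Finset.coe_filter, Finset.mem_univ, true_and, Set.mem_ofPred_eq] at *
    exact ⟨h.anti _ _ hx.1 hx.2, (h.map_class x).trans hx.2⟩
  · intro x hx
    simp only [Finset.coe_filter, Finset.mem_univ, true_and, Set.mem_ofPred_eq] at *
    refine ⟨?_, (h.map_class x).trans hx.2⟩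
    rw [h.anti_iff ((h.map_class x).trans hx.2), h.involutive]
    exact hx.1

theorem unique (h : IsClassReversal w π) (h' : IsClassReversal w π') : π = π' := by
  have key : ∀ {σ τ : Equiv.Perm (Fin n)}, IsClassReversal w σ → IsClassReversal w τ →
      ∀ p, ¬ σ p < τ p := by
    intro σ τ hσ hτ p hlt
    have e := (hσ.card_lt_eq p).symm.trans (hτ.card_lt_eq p)
    refine (Finset.card_lt_card (Finset.ssubset_iff_of_subset ?_ |>.2 ⟨τ p, ?_, ?_⟩)).ne' e
    · intro x hx
      simp only [Finset.mem_filter, Finset.mem_univ, true_and] at *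
      exact ⟨hlt.trans hx.1, hx.2⟩
    · simp [hlt, hτ.map_class]
    · simp
  ext p
  exact congrArg _ (le_antisymm (not_lt.1 (key h' h p)) (not_lt.1 (key h h' p)))

/-- Two of any three positions share a class, and there the order is reversed. -/
theorem avoids123 (h : IsClassReversal w π) : Avoids123 π := by
  rintro ⟨i, j, k, hij, hjk, h1, h2⟩
  have n1 : w i ≠ w j := fun e => (h.anti i j hij e).not_gt h1
  have n2 : w j ≠ w k := fun e => (h.anti j k hjk e).not_gt h2
  have n3 : w i ≠ w k := fun e => (h.anti i k (hij.trans hjk) e).not_gt (h1.trans h2)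
  revert n1 n2 n3
  cases w i <;> cases w j <;> cases w k <;> simp

end IsClassReversal

end Reversal

section Avoiding

variable {n : ℕ} {π : Equiv.Perm (Fin n)}

/-- The word of a permutation: `p` is an up if `(p, π p)` lies on or below the antidiagonal. -/
def belowWord (π : Equiv.Perm (Fin n)) (p : Fin n) : Bool := decide (p.val + (π p).val < n)

theorem belowWord_eq_true {p : Fin n} : belowWord π p = true ↔ p.val + (π p).val < n := by
  simp [belowWord]

theorem belowWord_eq_false {p : Fin n} : belowWord π p = false ↔ n ≤ p.val + (π p).val := by
  simp [belowWord]

/-- Every position after `j` has a value below `π j`, as otherwise it would complete a `123`; with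
`i` this makes `n - j` values below `π j`. -/
theorem Avoids123.belowWord_right (h : Avoids123 π) {i j : Fin n} (hij : i < j)
    (hπ : π i < π j) : belowWord π j = false := by
  have hc : #(insert i (Finset.Ioi j)) ≤ #(Finset.Iio (π j)) := by
    refine Finset.card_le_card_of_injOn π ?_ π.injective.injOn
    intro x hx
    simp only [Finset.coe_insert, Finset.coe_Ioi, Finset.coe_Iio, Set.mem_insert_iff, Set.mem_Ioi,
      Set.mem_Iio] at *
    rcases hx with rfl | hx
    · exact hπ
    · refine lt_of_le_of_ne (not_lt.1 fun h' => h ⟨i, j, x, hij, hx, hπ, h'⟩) fun e => ?_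
      exact hx.ne' (π.injective e)
  rw [Finset.card_insert_of_notMem (by simpa using hij.le), Fin.card_Ioi, Fin.card_Iio] at hc
  rw [belowWord_eq_false]
  omega

/-- Dually, all `i` positions before `i` have values above `π i`. -/
theorem Avoids123.belowWord_left (h : Avoids123 π) {i j : Fin n} (hij : i < j)
    (hπ : π i < π j) : belowWord π i = true := by
  have hc : #(Finset.Iio i) ≤ #(Finset.Ioi (π i)) := by
    refine Finset.card_le_card_of_injOn π ?_ π.injective.injOn
    intro x hx
    simp only [Finset.coe_Ioi, Finset.coe_Iio, Set.mem_Ioi, Set.mem_Iio] at *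
    refine lt_of_le_of_ne (not_lt.1 fun h' => h ⟨x, i, j, hx, hij, h', hπ⟩) fun e => ?_
    exact hx.ne' (π.injective e)
  rw [Fin.card_Ioi, Fin.card_Iio] at hc
  rw [belowWord_eq_true]
  omega

theorem Avoids123.isClassReversal (h : Avoids123 π) (hinv : ∀ p, π (π p) = p) :
    IsClassReversal (belowWord π) π where
  involutive := hinv
  map_class p := by simp [belowWord, hinv, add_comm]
  anti i j hij hw := by
    refine lt_of_le_of_ne (not_lt.1 fun h' => ?_) fun e => hij.ne' (π.injective e)
    rw [h.belowWord_left hij h', h.belowWord_right hij h'] at hw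
    exact absurd hw (by simp)

theorem Avoids123.lt_iff (h : Avoids123 π) {i j : Fin n} (hij : i.val + 1 = j.val) :
    π i < π j ↔ belowWord π i = true ∧ belowWord π j = false := by
  have hlt : i < j := Fin.lt_def.2 (by omega)
  refine ⟨fun hπ => ⟨h.belowWord_left hlt hπ, h.belowWord_right hlt hπ⟩, fun ⟨h1, h2⟩ => ?_⟩
  rw [belowWord_eq_true] at h1
  rw [belowWord_eq_false] at h2
  refine lt_of_le_of_ne (Fin.le_def.2 (by omega)) fun e => hlt.ne (π.injective e)

/-- The involution itself injects the downs among the first `k + 1` positions into the downs among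
the last `k`. -/
theorem revDominated_belowWord (hinv : ∀ p, π (π p) = p) :
    RevDominated 0 (List.ofFn (belowWord π)) := by
  rw [revDominated_ofFn]
  intro k hk
  refine Finset.card_le_card_of_injOn π ?_ π.injective.injOn
  intro c hc
  simp only [Finset.coe_filter, Finset.mem_univ, true_and, Set.mem_ofPred_eq,
    belowWord_eq_false, hinv] at *
  omega

/-- A position on the wrong side of the antidiagonal contradicts domination, since `p` has as many
class members before it as `π p` has after it. -/
theorem IsClassReversal.belowWord_eq {w : Fin n → Bool} (h : IsClassReversal w π)
    (hw : RevDominated 0 (List.ofFn w)) : belowWord π = w := by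
  rw [revDominated_ofFn] at hw
  funext p
  have hc := h.card_lt_eq p
  cases hp : w p
  · rw [belowWord_eq_false]
    by_contra! hlt
    rw [hp] at hc
    have h1 := hw p p.2
    have h2 : #{c : Fin n | c < p ∧ w c = false} < #{c : Fin n | c.val < p.val + 1 ∧ w c = false} := by
      refine Finset.card_lt_card (Finset.ssubset_iff_of_subset ?_ |>.2 ⟨p, ?_, ?_⟩)
      · intro x hx
        simp only [Finset.mem_filter, Finset.mem_univ, true_and, Fin.lt_def] at *
        exact ⟨by omega, hx.2⟩
      · simp [hp]
      · simp
    have h3 : #{c : Fin n | n ≤ c.val + p.val ∧ w c = false} ≤ #{c | π p < c ∧ w c = false} := by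
      refine Finset.card_le_card fun x hx => ?_
      simp only [Finset.mem_filter, Finset.mem_univ, true_and, Fin.lt_def] at *
      exact ⟨by omega, hx.2⟩
    omega
  · rw [belowWord_eq_true]
    by_contra! hle
    rw [hp] at hc
    -- Enlarging the final window from `p - 1` to `p` positions makes both windows equally long, so
    -- domination for downs becomes the reverse inequality for ups; `π p`, an up in the final
    -- window, breaks it.
    have h1 := hw (p.val - 1) (by omega)
    have hp0 : 0 < p.val := by have := (π p).2; omega
    rw [Nat.sub_add_cancel hp0] at h1
    have split : ∀ P : Fin n → Prop, ∀ [DecidablePred P], #{c | P c} =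
        #{c | P c ∧ w c = true} + #{c | P c ∧ w c = false} := by
      intro P _
      rw [← Finset.card_filter_add_card_filter_not (s := {c | P c}) (fun c => w c = true),
        Finset.filter_filter, Finset.filter_filter]
      simp
    have e1 := split (fun c => c < p)
    have e2 := split (fun c => n ≤ c.val + p.val)
    have c1 : #{c : Fin n | c < p} = p.val := by
      rw [← Fin.card_Iio p]
      congr 1
      ext
      simp
    have c2 : #{c : Fin n | n ≤ c.val + p.val} = p.val := by
      have : ({c : Fin n | n ≤ c.val + p.val} : Finset (Fin n)) =
          Finset.Ici ⟨n - p.val, by omega⟩ := by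
        ext
        simp [Fin.le_def]
      rw [this, Fin.card_Ici]
      simp only
      omega
    have h2 : #{c : Fin n | π p < c ∧ w c = true} <
        #{c : Fin n | n ≤ c.val + p.val ∧ w c = true} := by
      refine Finset.card_lt_card (Finset.ssubset_iff_of_subset ?_ |>.2 ⟨π p, ?_, ?_⟩)
      · intro x hx
        simp only [Finset.mem_filter, Finset.mem_univ, true_and, Fin.lt_def] at *
        exact ⟨by omega, hx.2⟩
      · simp only [Finset.mem_filter, Finset.mem_univ, true_and, h.map_class, hp, and_true]
        omega
      · simp
    have h3 : #{c : Fin n | n ≤ c.val + (p.val - 1) ∧ w c = false} ≤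
        #{c : Fin n | n ≤ c.val + p.val ∧ w c = false} := by
      refine Finset.card_le_card fun x hx => ?_
      simp only [Finset.mem_filter, Finset.mem_univ, true_and] at *
      exact ⟨by omega, hx.2⟩
    simp only [← Fin.lt_def] at h1
    omega

theorem mem_involutionsAvoiding123 :
    π ∈ involutionsAvoiding123 n ↔ (∀ p, π (π p) = p) ∧ Avoids123 π := by
  rw [involutionsAvoiding123, Finset.mem_filter, eq_inv_iff_mul_eq_one, Equiv.ext_iff]
  simp

theorem pow_comaj (h : Avoids123 π) :
    (X : ℚ[X]) ^ comaj π = peakWeight (fun i => X ^ i) 0 false (List.ofFn (belowWord π)) true := by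
  -- Position `0` may be included: it is never an ascent, and correspondingly the prepended `false`
  -- creates no peak. The prepended letter also makes peak positions agree with ascent positions
  -- counted from `1`.
  have hsub : ascentSet π = {i ∈ Finset.range n | i ∈ ascentSet π} := by
    ext i
    simp only [ascentSet, Finset.mem_filter, Finset.mem_Ico, Finset.mem_range]
    tauto
  rw [comaj, ← Finset.prod_pow_eq_pow_sum, hsub, Finset.prod_filter, Finset.prod_range,
    peakWeight_ofFn]
  refine Finset.prod_congr rfl fun p _ => ?_
  rcases n with _ | n
  · exact p.elim0
  · refine Fin.cases ?_ (fun q => ?_) p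
    · simp [ascentSet]
    · rw [Fin.castSucc_succ, Fin.cons_succ, zero_add]
      have hasc : q.succ.val ∈ ascentSet π ↔
          belowWord π q.castSucc = true ∧ belowWord π q.succ = false := by
        rw [← h.lt_iff (by simp), ascentSet, Finset.mem_filter, Finset.mem_Ico]
        constructor
        · rintro ⟨-, a, b, ha, hb, hab⟩
          rwa [show q.castSucc = a from Fin.ext (by simp at ha ⊢; omega),
            show q.succ = b from Fin.ext hb.symm]
        · intro hlt
          exact ⟨⟨by simp, q.succ.2⟩, q.castSucc, q.succ, by simp, rfl, hlt⟩
      simp only [hasc]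
      cases belowWord π q.castSucc <;> cases belowWord π q.succ <;> simp [peakFactor]

theorem sum_pow_comaj (n : ℕ) :
    ∑ π ∈ involutionsAvoiding123 n, (X : ℚ[X]) ^ comaj π =
      dominatedSum (fun i => (X : ℚ[X]) ^ i) 0 false true n 0 := by
  rw [dominatedSum, ← sum_ofFn_eq_wordSum, ← Finset.sum_filter]
  refine Finset.sum_bij (fun π _ => belowWord π) ?_ ?_ ?_ ?_
  · intro π hπ
    rw [mem_involutionsAvoiding123] at hπ
    simpa using revDominated_belowWord hπ.1
  · intro π hπ π' hπ' e
    rw [mem_involutionsAvoiding123] at hπ hπ'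
    have h := hπ.2.isClassReversal hπ.1
    have e' : belowWord π = belowWord π' := e
    rw [e'] at h
    exact h.unique (hπ'.2.isClassReversal hπ'.1)
  · intro w hw
    obtain ⟨π, hπ⟩ := exists_isClassReversal w
    exact ⟨π, mem_involutionsAvoiding123.2 ⟨hπ.involutive, hπ.avoids123⟩,
      hπ.belowWord_eq (Finset.mem_filter.1 hw).2⟩
  · intro π hπ
    exact pow_comaj (mem_involutionsAvoiding123.1 hπ).2

end Avoiding

end Permutations

theorem mainTheorem6 (n : ℕ) (hn : 1 ≤ n) :
    ∑ π ∈ involutionsAvoiding123 n, (X : ℚ[X]) ^ comaj π = qBinomial n (n / 2) := by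
  rw [sum_pow_comaj, dominatedSum_eq_qBinomial]
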